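/- Let $k,n>1$ be integers and let $\Sigma_k$ be an alphabet of $k$ symbols. The reflection of a word $v=v_1v_2\cdots v_m$ over $\Sigma_k$ is $v'=v_mv_{m-1}\cdots v_1$, and $[v]=\{v,v'\}$ is its reflection class. A subword of a word is a block of consecutive letters of it. An unoriented de Bruijn sequence $uB(k,n)$ is a finite word over $\Sigma_k$ that contains as a subword at least one member of every reflection class of words of length $n$, and that has the smallest length among all words with this property. It has optimal length if its length is $$l(k,n)=\frac{k^n+k^{\lceil n/2\rceil}+2n-2}{2}.$$ The unoriented de Bruijn graph $uBg(k,n)$ is the multigraph whose vertices are the reflection classes of words of length $n-1$ and whose edges are the reflection classes of words of length $n$, where the edge $[e]$ joins the classes of the words formed by the first $n-1$ and by the last $n-1$ letters of $e$. Let $ov(k,n)$ be the number of vertices of odd degree of $uBg(k,n)$, a loop contributing two to the degree. Then an unoriented de Bruijn sequence $uB(k,n)$ of optimal length $l(k,n)$ exists if and only if $k$ is $2$ or odd, and $n\le 3$. Moreover, $$ov(k,n)=\begin{cases}k^{n/2}, & n \text{ even},\ k\text{ even},\\ k^{(n+1)/2}-k^2+k, & n\text{ odd},\ k\text{ even},\\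 2(k^{n/2}-k), & n\text{ even},\ k\text{ odd},\\ k^{(n+1)/2}+k^{(n-1)/2}-k^2-k, & n\text{ odd},\ k\text{ odd},\end{cases}$$ and $ov(k,n)\le 2$ if and only if $k$ is $2$ or odd, and $n\le 3$. -/

import Mathlib

namespace UnorientedDeBruijn

/-- A word of length `m` over the alphabet `Fin k` of `k` symbols. -/
abbrev Word (k m : ℕ) : Type := Fin m → Fin k

/-- The reflection of a word: `v_1 v_2 ⋯ v_m` becomes `v_m ⋯ v_2 v_1`. -/
def reflect {k m : ℕ} (v : Word k m) : Word k m := fun i => v i.rev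

theorem reflect_reflect {k m : ℕ} (v : Word k m) : reflect (reflect v) = v := by
  funext i
  simp [reflect]

/-- The finite sequence `s` contains the word `v` as a subword (a block of consecutive letters). -/
def IsSubword {k m : ℕ} (v : Word k m) (s : List (Fin k)) : Prop := List.ofFn v <:+: s

/-- The sequence `s` contains a member of each pair of reflections of length `n`. -/
def CoversReflections (k n : ℕ) (s : List (Fin k)) : Prop :=
  ∀ v : Word k n, IsSubword v s ∨ IsSubword (reflect v) s

/-- An unoriented de Bruijn sequence `uB(k,n)`: a shortest sequence among those containing a
member of each pair of reflections of length `n`. -/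
def IsUnorientedDeBruijnSeq (k n : ℕ) (s : List (Fin k)) : Prop :=
  CoversReflections k n s ∧ ∀ t : List (Fin k), CoversReflections k n t → s.length ≤ t.length

/-- `l(k,n) = (k ^ n + k ^ ⌈n / 2⌉ + 2 n - 2) / 2`, where `⌈n / 2⌉ = (n + 1) / 2` in `ℕ`. For
`1 ≤ n` neither the subtraction nor the division by two loses anything. -/
def optimalLength (k n : ℕ) : ℕ := (k ^ n + k ^ ((n + 1) / 2) + 2 * n - 2) / 2

theorem two_mul_optimalLength (k n : ℕ) (hn : 1 ≤ n) :
    2 * (optimalLength k n : ℤ) = (k : ℤ) ^ n + (k : ℤ) ^ ((n + 1) / 2) + 2 * n - 2 := by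
  have h : Even (k ^ n + k ^ ((n + 1) / 2)) := by
    have h1 : n ≠ 0 := by omega
    have h2 : (n + 1) / 2 ≠ 0 := by omega
    rw [Nat.even_add, Nat.even_pow' h1, Nat.even_pow' h2]
  obtain ⟨a, ha⟩ := h
  have h3 : 2 * optimalLength k n + 2 = k ^ n + k ^ ((n + 1) / 2) + 2 * n := by
    unfold optimalLength
    omega
  have h4 := congrArg (Nat.cast : ℕ → ℤ) h3
  push_cast at h4
  linarith

/-- Two words are identified when they are equal or reflections of each other. -/
instance reflectSetoid (k m : ℕ) : Setoid (Word k m) where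
  r v w := w = v ∨ w = reflect v
  iseqv :=
    { refl := fun _ => Or.inl rfl
      symm := by
        rintro v w (rfl | rfl)
        · exact Or.inl rfl
        · exact Or.inr (reflect_reflect v).symm
      trans := by
        rintro u v w (rfl | rfl) (rfl | rfl)
        · exact Or.inl rfl
        · exact Or.inr rfl
        · exact Or.inr rfl
        · exact Or.inl (reflect_reflect u) }

/-- The reflection classes `[v]` of words of length `m`. -/
def ReflClass (k m : ℕ) : Type := Quotient (reflectSetoid k m)

/-- The reflection class `[v]` of a word `v`. -/
def cls {k m : ℕ} (v : Word k m) : ReflClass k m := Quotient.mk (reflectSetoid k m) v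

/-- The prefix of a word of length `n`: its first `n - 1` letters. -/
def pre {k n : ℕ} (e : Word k n) : Word k (n - 1) := fun i => e ⟨i, by omega⟩

/-- The suffix of a word of length `n`: its last `n - 1` letters. -/
def suf {k n : ℕ} (e : Word k n) : Word k (n - 1) := fun i => e ⟨i + 1, by omega⟩

theorem cls_eq_iff {k m : ℕ} (v w : Word k m) : cls v = cls w ↔ w = v ∨ w = reflect v :=
  Quotient.eq (r := reflectSetoid k m)

theorem cls_reflect {k m : ℕ} (v : Word k m) : cls (reflect v) = cls v :=
  ((cls_eq_iff v (reflect v)).2 (Or.inr rfl)).symm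

theorem pre_reflect {k n : ℕ} (e : Word k n) : pre (reflect e) = reflect (suf e) := by
  funext i
  simp only [pre, suf, reflect]
  congr 1
  ext
  simp only [Fin.val_rev]
  omega

theorem suf_reflect {k n : ℕ} (e : Word k n) : suf (reflect e) = reflect (pre e) := by
  funext i
  simp only [pre, suf, reflect]
  congr 1
  ext
  simp only [Fin.val_rev]
  omega

/-- The unoriented de Bruijn graph `uBg(k,n)`, a multigraph with loops: its vertices are the
reflection classes of words of length `n - 1`, its edges are the reflection classes of words of
length `n`, and the edge `[e]` joins the classes of the prefix and of the suffix of `e`. -/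
def uBg (k n : ℕ) : Graph (ReflClass k (n - 1)) (ReflClass k n) where
  vertexSet := Set.univ
  edgeSet := Set.univ
  IsLink a x y := ∃ e : Word k n, cls e = a ∧ cls (pre e) = x ∧ cls (suf e) = y
  isLink_symm := by
    refine fun a _ => ⟨?_⟩
    rintro x y ⟨e, rfl, rfl, rfl⟩
    exact ⟨reflect e, cls_reflect e, by rw [pre_reflect, cls_reflect],
      by rw [suf_reflect, cls_reflect]⟩
  eq_or_eq_of_isLink_of_isLink := by
    rintro a x y v w ⟨e, rfl, rfl, rfl⟩ ⟨f, hf, rfl, rfl⟩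
    rcases (cls_eq_iff f e).1 hf with rfl | rfl
    · exact Or.inl rfl
    · exact Or.inr (by rw [pre_reflect, cls_reflect])
  edge_mem_iff_exists_isLink := by
    intro a
    refine ⟨fun _ => ?_, fun _ => Set.mem_univ a⟩
    obtain ⟨e, rfl⟩ := Quotient.exists_rep a
    exact ⟨_, _, e, rfl, rfl, rfl⟩
  left_mem_of_isLink := fun _ x _ _ => Set.mem_univ x

/-- The degree of the vertex `x` in `uBg(k,n)`: the number of edges incident to `x`, where each
loop at `x` is counted twice. -/
noncomputable def degree (k n : ℕ) (x : ReflClass k (n - 1)) : ℕ :=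
  {a : ReflClass k n | (uBg k n).Inc a x}.ncard +
    {a : ReflClass k n | (uBg k n).IsLoopAt a x}.ncard

/-- `ov(k,n)`: the number of vertices of odd degree of `uBg(k,n)`. -/
noncomputable def ov (k n : ℕ) : ℕ := {x : ReflClass k (n - 1) | Odd (degree k n x)}.ncard

end UnorientedDeBruijn

namespace UnorientedDeBruijn

open Finset
open scoped Classical

/-! Counting words against palindromes shows that `optimalLength` is the number of reflection
classes plus `n - 1`. A covering word of that length therefore has one window per class: its windows
form an Eulerian trail of `uBg k n`, so `ov k n ≤ 2`.

Degrees are counted side by side. A vertex `[v]` has the sides `v` and `v'`, which coincide when `v`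
is a palindrome. The side `v` carries `k` edge ends, and one more when `v` is the prefix of a
palindrome of length `n` (`sum_outCount`). So the parity of a degree depends only on which of `v`,
`v'` extend to palindromes, and counting such words gives `ov` and the bound `n ≤ 3`.

Conversely, a word is more than an Eulerian trail: on reaching `v` as a suffix it must continue with
`v` as a prefix. For `n ≤ 3` every side carries exactly `k + 1` ends, so the two sides of a
non-palindrome balance; at a palindrome `k + 1` must be even, hence `k` odd. Then a longest trail
closes up (`IsLongestTrail.closed`), can be rotated, and by connectedness uses every class. For `k =
2` explicit words suffice. -/

noncomputable instance (k m : ℕ) : Fintype (ReflClass k m) :=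
  @Fintype.ofFinite _ (inferInstanceAs (Finite (Quotient (reflectSetoid k m))))

/-! ### Counting reflection classes and palindromes -/

theorem reflect_injective {k m : ℕ} : Function.Injective (reflect : Word k m → Word k m) :=
  Function.LeftInverse.injective reflect_reflect

theorem reflect_eq_comm {k m : ℕ} {v w : Word k m} : reflect v = w ↔ v = reflect w :=
  ⟨fun h => by rw [← h, reflect_reflect], fun h => by rw [h, reflect_reflect]⟩

theorem cls_surjective {k m : ℕ} : Function.Surjective (cls : Word k m → ReflClass k m) :=
  Quotient.exists_rep

/-- A class consists of two words or of a single palindrome; counting palindromes once more makes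
every class count twice. -/
theorem two_mul_sum_reflClass {k m : ℕ} (f : ReflClass k m → ℕ) :
    2 * ∑ a, f a = ∑ e : Word k m, f (cls e) + ∑ e : Word k m with reflect e = e, f (cls e) := by
  rw [sum_filter, ← sum_add_distrib,
    ← sum_fiberwise (s := (univ : Finset (Word k m))) (g := cls), mul_sum]
  refine sum_congr rfl fun a _ => ?_
  obtain ⟨v, rfl⟩ := cls_surjective a
  have h : ({e | cls e = cls v} : Finset (Word k m)) = {v, reflect v} := by
    ext e
    simp only [mem_filter, mem_univ, true_and, mem_insert, mem_singleton]
    rw [eq_comm, cls_eq_iff]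
  rw [h]
  by_cases hv : reflect v = v
  · simp [hv, two_mul]
  · have hv' : v ≠ reflect v := Ne.symm hv
    rw [sum_pair hv']
    simp [hv, hv', reflect_reflect, cls_reflect, two_mul]

theorem reflect_eq_self_iff {k m : ℕ} (v : Word k m) :
    reflect v = v ↔ ∀ i j : Fin m, (i : ℕ) + j + 1 = m → v i = v j := by
  constructor
  · intro h i j hij
    have : i = j.rev := by ext; simp only [Fin.val_rev]; omega
    rw [this]
    exact congrFun h j
  · intro h
    funext i
    exact h _ _ (by simp only [Fin.val_rev]; omega)

theorem card_palindromes (k m : ℕ) :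
    #{e : Word k m | reflect e = e} = k ^ ((m + 1) / 2) := by
  have h : Fintype.card (Word k ((m + 1) / 2)) = k ^ ((m + 1) / 2) := by simp
  rw [← h, ← card_univ]
  refine card_bij' (fun e _ i => e ⟨i, by omega⟩)
    -- Folding the positions at the centre rebuilds a palindrome from its first half.
    (fun w _ i => w ⟨min i (m - 1 - i), by omega⟩) ?_ ?_ ?_ ?_
  · simp
  · intro w _
    simp only [mem_filter, mem_univ, true_and, reflect_eq_self_iff]
    intro i j hij
    congr 2
    omega
  · intro e he
    simp only [mem_filter, mem_univ, true_and, reflect_eq_self_iff] at he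
    funext i
    rcases le_total (i : ℕ) (m - 1 - i) with hi | hi
    · refine congrArg e (Fin.ext ?_)
      simpa using hi
    · refine he _ _ ?_
      simp only [min_eq_right hi]
      omega
  · intro w _
    funext i
    refine congrArg w (Fin.ext ?_)
    simp only
    omega

theorem two_mul_card_reflClass (k n : ℕ) :
    2 * Fintype.card (ReflClass k n) = k ^ n + k ^ ((n + 1) / 2) := by
  have h := two_mul_sum_reflClass (k := k) (m := n) fun _ => 1
  rw [sum_const, sum_const, sum_const, card_palindromes] at h
  simpa using h

theorem optimalLength_eq (k n : ℕ) (hn : 1 ≤ n) :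
    optimalLength k n = Fintype.card (ReflClass k n) + (n - 1) := by
  have h := two_mul_card_reflClass k n
  unfold optimalLength
  omega

/-! ### Palindromic extensions and vertex degrees -/

theorem pre_eq_pre_of_palindrome {k n : ℕ} (hn : 1 < n) {e f : Word k n} (he : reflect e = e)
    (hf : reflect f = f) (h : pre e = pre f) : e = f := by
  rw [reflect_eq_self_iff] at he hf
  funext i
  have key : ∀ i : Fin n, (i : ℕ) < n - 1 → e i = f i := fun i hi => congrFun h ⟨i, hi⟩
  by_cases hi : (i : ℕ) < n - 1
  · exact key i hi
  · rw [he i ⟨0, by omega⟩ (by simp only; omega), hf i ⟨0, by omega⟩ (by simp only; omega)]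
    exact key _ (by simp only; omega)

theorem card_pre_eq {k n : ℕ} (hn : 1 ≤ n) (v : Word k (n - 1)) :
    #{e : Word k n | pre e = v} = k := by
  obtain ⟨m, rfl⟩ : ∃ m, n = m + 1 := ⟨n - 1, by omega⟩
  have h : #(univ : Finset (Fin k)) = k := by simp
  conv_rhs => rw [← h]
  refine card_bij' (fun e _ => e (Fin.last m)) (fun a _ => Fin.snoc (n := m) (α := fun _ => Fin k) v a)
    ?_ ?_ ?_ ?_
  · simp
  · intro a _
    simp only [mem_filter, mem_univ, true_and]
    exact Fin.init_snoc (n := m) (α := fun _ => Fin k) a v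
  · intro e he
    simp only [mem_filter, mem_univ, true_and] at he
    subst he
    exact Fin.snoc_init_self (α := fun _ => Fin k) e
  · intro a _
    simp

/-- The word `v` of length `n - 1` is a prefix of a palindrome of length `n`. -/
def PalExtendable {k n : ℕ} (v : Word k (n - 1)) : Prop :=
  ∃ e : Word k n, reflect e = e ∧ pre e = v

theorem card_palindromes_pre_eq {k n : ℕ} (hn : 1 < n) (v : Word k (n - 1)) :
    #{e : Word k n | reflect e = e ∧ pre e = v} = if PalExtendable v then 1 else 0 := by
  split_ifs with h
  · obtain ⟨e, he, rfl⟩ := h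
    rw [card_eq_one]
    refine ⟨e, ?_⟩
    ext f
    simp only [mem_filter, mem_univ, true_and, mem_singleton]
    constructor
    · rintro ⟨hf, h⟩
      exact pre_eq_pre_of_palindrome hn hf he h
    · rintro rfl
      exact ⟨he, rfl⟩
  · rw [card_eq_zero, filter_eq_empty_iff]
    intro e _ he
    exact h ⟨e, he⟩

theorem suf_eq_iff {k n : ℕ} (e : Word k n) (v : Word k (n - 1)) :
    suf e = v ↔ pre (reflect e) = reflect v := by
  rw [pre_reflect, reflect_injective.eq_iff]

/-- The number of ways in which the class `a` gives an edge leaving the word `v` on its right. -/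
noncomputable def outCount {k n : ℕ} (v : Word k (n - 1)) (a : ReflClass k n) : ℕ :=
  Quotient.lift (s := reflectSetoid k n)
    (fun e => (if pre e = v then 1 else 0) + if suf e = reflect v then 1 else 0) (by
      rintro e _ (rfl | rfl)
      · rfl
      · simp only [pre_reflect, suf_reflect, reflect_injective.eq_iff, reflect_eq_comm]
        exact add_comm _ _) a

theorem outCount_cls {k n : ℕ} (v : Word k (n - 1)) (e : Word k n) :
    outCount v (cls e) = (if pre e = v then 1 else 0) + if suf e = reflect v then 1 else 0 :=
  rfl

/-- Each of the `k` words with prefix `v` leaves `v`, as does its reflection. A palindrome among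
them is its own reflection, so its class counts twice. -/
theorem sum_outCount {k n : ℕ} (hn : 1 < n) (v : Word k (n - 1)) :
    ∑ a, outCount v a = k + if PalExtendable v then 1 else 0 := by
  have h := two_mul_sum_reflClass (outCount v)
  have h1 : ∑ e : Word k n, outCount v (cls e) = 2 * k := by
    simp only [outCount_cls, sum_add_distrib]
    have h2 : ∑ e : Word k n, (if suf e = reflect v then 1 else 0) =
        ∑ e : Word k n, if pre e = v then 1 else 0 := by
      refine Fintype.sum_equiv (Function.Involutive.toPerm reflect reflect_reflect) _ _ fun e => ?_
      simp only [suf_eq_iff, reflect_reflect]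
      rfl
    rw [h2, ← card_filter, card_pre_eq hn.le, two_mul]
  have h2 : ∑ e : Word k n with reflect e = e, outCount v (cls e) =
      2 * if PalExtendable v then 1 else 0 := by
    rw [← card_palindromes_pre_eq hn, ← filter_filter, card_filter, mul_sum]
    refine sum_congr rfl fun e he => ?_
    rw [mem_filter] at he
    simp only [outCount_cls, suf_eq_iff, reflect_reflect, he.2, two_mul]
  omega

/-- The multiplicity of `x` as an end of the edge `a`: a loop at `x` counts twice. -/
noncomputable def endCount {k n : ℕ} (x : ReflClass k (n - 1)) (a : ReflClass k n) : ℕ :=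
  (if (uBg k n).Inc a x then 1 else 0) + if (uBg k n).IsLoopAt a x then 1 else 0

theorem isLink_cls {k n : ℕ} (e : Word k n) (x y : ReflClass k (n - 1)) :
    (uBg k n).IsLink (cls e) x y ↔
      (cls (pre e) = x ∧ cls (suf e) = y) ∨ (cls (suf e) = x ∧ cls (pre e) = y) := by
  constructor
  · rintro ⟨f, hf, rfl, rfl⟩
    rcases (cls_eq_iff f e).1 hf with rfl | rfl
    · exact Or.inl ⟨rfl, rfl⟩
    · exact Or.inr ⟨by rw [suf_reflect, cls_reflect], by rw [pre_reflect, cls_reflect]⟩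
  · rintro (⟨rfl, rfl⟩ | ⟨rfl, rfl⟩)
    · exact ⟨e, rfl, rfl, rfl⟩
    · exact ⟨reflect e, cls_reflect e, by rw [pre_reflect, cls_reflect],
        by rw [suf_reflect, cls_reflect]⟩

theorem endCount_cls {k n : ℕ} (x : ReflClass k (n - 1)) (e : Word k n) :
    endCount x (cls e) =
      (if cls (pre e) = x then 1 else 0) + if cls (suf e) = x then 1 else 0 := by
  have h1 : (uBg k n).Inc (cls e) x ↔ cls (pre e) = x ∨ cls (suf e) = x := by
    simp only [Graph.Inc, isLink_cls]
    exact ⟨fun ⟨_, h⟩ => h.imp And.left And.left,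
      fun h => h.elim (fun h => ⟨_, Or.inl ⟨h, rfl⟩⟩) fun h => ⟨_, Or.inr ⟨h, rfl⟩⟩⟩
  have h2 : (uBg k n).IsLoopAt (cls e) x ↔ cls (pre e) = x ∧ cls (suf e) = x := by
    simp only [Graph.IsLoopAt, isLink_cls]
    tauto
  rw [endCount]
  simp only [h1, h2]
  split_ifs <;> simp_all

theorem degree_eq_sum {k n : ℕ} (x : ReflClass k (n - 1)) :
    degree k n x = ∑ a, endCount x a := by
  simp only [degree, endCount, sum_add_distrib, ← card_filter, Set.ncard_eq_toFinset_card']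
  simp

theorem cls_eq_cls_iff {k m : ℕ} (v w : Word k m) : cls v = cls w ↔ v = w ∨ v = reflect w := by
  rw [eq_comm, cls_eq_iff]

theorem degree_of_palindrome {k n : ℕ} (hn : 1 < n) {v : Word k (n - 1)} (hv : reflect v = v) :
    degree k n (cls v) = k + if PalExtendable v then 1 else 0 := by
  rw [degree_eq_sum, ← sum_outCount hn]
  refine sum_congr rfl fun a _ => ?_
  obtain ⟨e, rfl⟩ := cls_surjective a
  simp only [endCount_cls, outCount_cls, cls_eq_cls_iff, hv, or_self]

theorem degree_of_not_palindrome {k n : ℕ} (hn : 1 < n) {v : Word k (n - 1)}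
    (hv : reflect v ≠ v) :
    degree k n (cls v) = 2 * k + ((if PalExtendable v then 1 else 0) +
      if PalExtendable (reflect v) then 1 else 0) := by
  have h : degree k n (cls v) = ∑ a, outCount v a + ∑ a, outCount (reflect v) a := by
    rw [degree_eq_sum, ← sum_add_distrib]
    refine sum_congr rfl fun a _ => ?_
    obtain ⟨e, rfl⟩ := cls_surjective a
    have key : ∀ w : Word k (n - 1), (if w = v ∨ w = reflect v then 1 else 0) =
        (if w = v then 1 else 0) + if w = reflect v then 1 else 0 := by
      intro w
      by_cases h1 : w = v
      · subst h1
        simp [Ne.symm hv]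
      · simp [h1]
    simp only [endCount_cls, outCount_cls, cls_eq_cls_iff, key, reflect_reflect]
    ring
  rw [h, sum_outCount hn, sum_outCount hn]
  ring

/-! ### Counting extendable words -/

theorem palExtendable_iff {k n : ℕ} (hn : 1 < n) (v : Word k (n - 1)) :
    PalExtendable v ↔ ∀ i j : Fin (n - 1), (i : ℕ) + j = n - 1 → v i = v j := by
  constructor
  · rintro ⟨e, he, rfl⟩ i j hij
    exact (reflect_eq_self_iff e).1 he _ _ (by simp only; omega)
  · intro h
    have hlt : ∀ i : ℕ, i % (n - 1) < n - 1 := fun i => Nat.mod_lt _ (by omega)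
    -- The remainder sends only the new last position `n - 1` back to `0`: the appended letter is
    -- the first letter of `v`.
    refine ⟨fun i => v ⟨i % (n - 1), hlt i⟩, ?_, ?_⟩
    · rw [reflect_eq_self_iff]
      intro i j hij
      by_cases hi : (i : ℕ) = n - 1
      · refine congrArg v (Fin.ext ?_)
        have hj : (j : ℕ) = 0 := by omega
        simp [hi, hj]
      by_cases hj : (j : ℕ) = n - 1
      · refine congrArg v (Fin.ext ?_)
        have hi : (i : ℕ) = 0 := by omega
        simp [hi, hj]
      refine h _ _ ?_
      simp only
      rw [Nat.mod_eq_of_lt (by omega), Nat.mod_eq_of_lt (by omega)]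
      omega
    · funext i
      exact congrArg v (Fin.ext (Nat.mod_eq_of_lt i.2))

theorem palExtendable_reflect_iff {k n : ℕ} (hn : 1 < n) (v : Word k (n - 1)) :
    PalExtendable (reflect v) ↔ ∀ i j : Fin (n - 1), (i : ℕ) + j + 2 = n - 1 → v i = v j := by
  rw [palExtendable_iff hn]
  constructor
  · intro h i j hij
    simpa [reflect] using h i.rev j.rev (by simp only [Fin.val_rev]; omega)
  · intro h i j hij
    exact h _ _ (by simp only [Fin.val_rev]; omega)

theorem palExtendable_of_le_three {k n : ℕ} (hn : 1 < n) (hn' : n ≤ 3) (v : Word k (n - 1)) :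
    PalExtendable v := by
  rw [palExtendable_iff hn]
  intro i j hij
  exact congrArg v (Fin.ext (by omega))

theorem card_palExtendable {k n : ℕ} (hn : 1 < n) :
    #{v : Word k (n - 1) | PalExtendable v} = k ^ ((n + 1) / 2) := by
  rw [← card_palindromes k n]
  symm
  refine card_bij (fun e _ => pre e) ?_ ?_ ?_
  · intro e he
    simp only [mem_filter, mem_univ, true_and] at he ⊢
    exact ⟨e, he, rfl⟩
  · intro e he f hf h
    simp only [mem_filter, mem_univ, true_and] at he hf
    exact pre_eq_pre_of_palindrome hn he hf h
  · intro v hv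
    simp only [mem_filter, mem_univ, true_and] at hv
    obtain ⟨e, he, rfl⟩ := hv
    exact ⟨e, by simpa using he, rfl⟩

/-- Being a palindrome and being extendable are the symmetries `i + j = n - 2` and `i + j = n - 1`.
Composed, they shift by one, so only constant words remain. -/
theorem card_palindromes_palExtendable {k n : ℕ} (hn : 1 < n) :
    #{v : Word k (n - 1) | reflect v = v ∧ PalExtendable v} = k := by
  have h : #(univ : Finset (Fin k)) = k := by simp
  conv_rhs => rw [← h]
  refine card_bij' (fun v _ => v ⟨0, by omega⟩) (fun a _ _ => a) ?_ ?_ ?_ ?_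
  · simp
  · intro a _
    simp only [mem_filter, mem_univ, true_and, palExtendable_iff hn]
    exact ⟨rfl, fun _ _ _ => trivial⟩
  · intro v hv
    simp only [mem_filter, mem_univ, true_and, palExtendable_iff hn, reflect_eq_self_iff] at hv
    obtain ⟨h1, h2⟩ := hv
    have key : ∀ (i : ℕ) (hi : i < n - 1), v ⟨0, by omega⟩ = v ⟨i, hi⟩ := by
      intro i
      induction i with
      | zero => intro _; rfl
      | succ i ih =>
        intro hi
        rw [ih (by omega), h1 ⟨i, by omega⟩ ⟨n - 1 - 1 - i, by omega⟩ (by simp only; omega)]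
        exact h2 _ _ (by simp only; omega)
    funext i
    exact key i i.2
  · intro a _
    rfl

/-- The symmetries `i + j = n - 1` and `i + j = n - 3` compose to a shift by two. For odd `n` both
preserve the parity of a position, so nothing beyond period two is forced. -/
theorem doubly_palExtendable_iff {k n : ℕ} (hn : 1 < n) (hodd : Odd n) (v : Word k (n - 1)) :
    (PalExtendable v ∧ PalExtendable (reflect v)) ↔
      ∀ i : Fin (n - 1), v i = v ⟨i % 2, by have := hodd; rw [Nat.odd_iff] at this; omega⟩ := by
  have h2 := Nat.odd_iff.1 hodd
  rw [palExtendable_reflect_iff hn, palExtendable_iff hn]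
  constructor
  · rintro ⟨h, h'⟩
    have key : ∀ (i : ℕ) (hi : i < n - 1), v ⟨i, hi⟩ = v ⟨i % 2, by omega⟩ := by
      intro i
      induction i using Nat.strong_induction_on with
      | _ i ih =>
        intro hi
        by_cases h3 : i < 2
        · exact congrArg v (Fin.ext (Nat.mod_eq_of_lt h3).symm)
        · rw [h ⟨i, hi⟩ ⟨n - 1 - i, by omega⟩ (by simp only; omega),
            h' _ ⟨i - 2, by omega⟩ (by simp only; omega), ih (i - 2) (by omega)]
          exact congrArg v (Fin.ext (by simp only; omega))
    exact fun i => key i i.2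
  · intro h
    refine ⟨fun i j hij => ?_, fun i j hij => ?_⟩ <;>
    · rw [h i, h j]
      exact congrArg v (Fin.ext (by simp only; omega))

theorem card_doubly_palExtendable_of_odd {k n : ℕ} (hn : 1 < n) (hodd : Odd n) :
    #{v : Word k (n - 1) | reflect v ≠ v ∧ PalExtendable v ∧ PalExtendable (reflect v)} =
      k * k - k := by
  have h2 := Nat.odd_iff.1 hodd
  have h : #(univ : Finset (Fin k)).offDiag = k * k - k := by simp [offDiag_card]
  rw [← h]
  refine card_bij' (fun v _ => (v ⟨0, by omega⟩, v ⟨1, by omega⟩))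
    (fun p _ i => if (i : ℕ) % 2 = 0 then p.1 else p.2) ?_ ?_ ?_ ?_
  · intro v hv
    simp only [mem_filter, mem_univ, true_and, doubly_palExtendable_iff hn hodd] at hv
    simp only [mem_offDiag, mem_univ, true_and]
    intro h01
    refine hv.1 ?_
    have key : ∀ i : Fin (n - 1), v i = v ⟨0, by omega⟩ := by
      intro i
      rw [hv.2 i]
      rcases Nat.mod_two_eq_zero_or_one i with h | h
      · exact congrArg v (Fin.ext h)
      · rw [h01]
        exact congrArg v (Fin.ext h)
    funext i
    rw [reflect, key i, key i.rev]
  · intro p hp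
    simp only [mem_offDiag, mem_univ, true_and] at hp
    simp only [mem_filter, mem_univ, true_and, doubly_palExtendable_iff hn hodd, Nat.mod_mod,
      implies_true, and_true]
    intro h
    rw [reflect_eq_self_iff] at h
    have := h ⟨0, by omega⟩ ⟨n - 2, by omega⟩ (by simp only; omega)
    simp only [Nat.zero_mod, if_true] at this
    rw [if_neg (by omega)] at this
    exact hp this
  · intro v hv
    simp only [mem_filter, mem_univ, true_and, doubly_palExtendable_iff hn hodd] at hv
    funext i
    rw [hv.2 i]
    split_ifs with h
    · exact congrArg v (Fin.ext h.symm)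
    · exact congrArg v (Fin.ext (by simp only; omega))
  · intro p _
    simp

/-- The shift by two remains, but for even `n` the symmetry `i + j = n - 1` exchanges parities, so
the word is constant and thus a palindrome. -/
theorem card_doubly_palExtendable_of_even {k n : ℕ} (hn : 1 < n) (heven : Even n) :
    #{v : Word k (n - 1) | reflect v ≠ v ∧ PalExtendable v ∧ PalExtendable (reflect v)} = 0 := by
  have h2 := Nat.even_iff.1 heven
  rw [card_eq_zero, filter_eq_empty_iff]
  rintro v - ⟨h, h1, h3⟩
  rw [palExtendable_reflect_iff hn] at h3
  rw [palExtendable_iff hn] at h1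
  refine h ((reflect_eq_self_iff v).2 ?_)
  have step : ∀ (i : ℕ) (hi : i + 2 < n - 1), v ⟨i + 2, hi⟩ = v ⟨i, by omega⟩ := by
    intro i hi
    rw [h1 ⟨i + 2, hi⟩ ⟨n - 1 - (i + 2), by omega⟩ (by simp only; omega)]
    exact h3 _ _ (by simp only; omega)
  have key : ∀ (i : ℕ) (hi : i < n - 1), v ⟨i, hi⟩ = v ⟨0, by omega⟩ := by
    have hev : ∀ (j : ℕ) (hj : 2 * j < n - 1), v ⟨2 * j, hj⟩ = v ⟨0, by omega⟩ := by
      intro j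
      induction j with
      | zero => intro _; rfl
      | succ j ih => intro hj; rw [← ih (by omega)]; exact step (2 * j) hj
    intro i hi
    rcases Nat.even_or_odd' i with ⟨j, rfl | rfl⟩
    · exact hev j hi
    · rw [h1 ⟨2 * j + 1, hi⟩ ⟨2 * ((n - 1 - (2 * j + 1)) / 2), by omega⟩ (by simp only; omega)]
      exact hev _ _
  intro i j _
  rw [key i i.2, key j j.2]

/-! ### Vertices of odd degree -/

/-- A non-palindromic class is odd when exactly one of its two words is extendable; that word serves
as its representative. -/
theorem ov_eq_card {k n : ℕ} (hn : 1 < n) :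
    ov k n = #{v : Word k (n - 1) | reflect v = v ∧ Odd (k + if PalExtendable v then 1 else 0)} +
      #{v : Word k (n - 1) | reflect v ≠ v ∧ PalExtendable v ∧ ¬ PalExtendable (reflect v)} := by
  rw [← card_union_of_disjoint (by
    rw [Finset.disjoint_left]
    intro v h1 h2
    simp only [mem_filter, mem_univ, true_and] at h1 h2
    exact h2.1 h1.1), ← filter_or]
  have hinj : Set.InjOn (cls : Word k (n - 1) → _)
      ({v : Word k (n - 1) | reflect v = v ∧ Odd (k + if PalExtendable v then 1 else 0) ∨
        reflect v ≠ v ∧ PalExtendable v ∧ ¬ PalExtendable (reflect v)} :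
        Finset (Word k (n - 1))) := by
    intro v hv w hw h
    simp only [coe_filter, mem_univ, true_and, Set.mem_ofPred_eq] at hv hw
    rcases (cls_eq_iff v w).1 h with rfl | rfl
    · rfl
    · rw [reflect_reflect] at hw
      rcases hv with hv | hv
      · exact hv.1.symm
      · rcases hw with hw | hw
        · exact hw.1
        · exact absurd hw.2.1 hv.2.2
  rw [← card_image_of_injOn hinj, ← Set.ncard_coe_finset, ov]
  congr 1
  ext x
  obtain ⟨v, rfl⟩ := cls_surjective x
  simp only [coe_image, coe_filter, mem_univ, true_and, Set.mem_image, Set.mem_ofPred_eq]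
  by_cases hv : reflect v = v
  · rw [degree_of_palindrome hn hv]
    constructor
    · exact fun h => ⟨v, Or.inl ⟨hv, h⟩, rfl⟩
    · rintro ⟨w, hw, h⟩
      have : w = v := by
        rcases (cls_eq_cls_iff w v).1 h with h | h
        · exact h
        · exact h.trans hv
      subst this
      rcases hw with hw | hw
      · exact hw.2
      · exact absurd hv hw.1
  · rw [degree_of_not_palindrome hn hv]
    constructor
    · intro h
      by_cases h1 : PalExtendable v <;> by_cases h2 : PalExtendable (reflect v)
      · exact absurd h (by simp [h1, h2, parity_simps])
      · exact ⟨v, Or.inr ⟨hv, h1, h2⟩, rfl⟩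
      · refine ⟨reflect v, Or.inr ⟨?_, h2, ?_⟩, cls_reflect v⟩
        · rw [reflect_reflect]; exact Ne.symm hv
        · rwa [reflect_reflect]
      · exact absurd h (by simp [h1, h2])
    · rintro ⟨w, hw, h⟩
      rcases (cls_eq_cls_iff w v).1 h with rfl | rfl
      · rcases hw with hw | hw
        · exact absurd hw.1 hv
        · simp [hw.2, parity_simps]
      · rw [reflect_reflect] at hw
        rcases hw with hw | hw
        · exact absurd hw.1.symm hv
        · simp [hw.2, parity_simps]

theorem card_nonpalindromes_eq {k n : ℕ} (hn : 1 < n) :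
    #{v : Word k (n - 1) | reflect v ≠ v ∧ PalExtendable v ∧ ¬ PalExtendable (reflect v)} +
      #{v : Word k (n - 1) | reflect v ≠ v ∧ PalExtendable v ∧ PalExtendable (reflect v)} + k =
        k ^ ((n + 1) / 2) := by
  rw [← card_palExtendable hn]
  refine (congrArg (_ + ·) (card_palindromes_palExtendable (k := k) hn).symm).trans ?_
  rw [← card_union_of_disjoint, ← card_union_of_disjoint, ← filter_or, ← filter_or]
  · congr 1
    ext v
    simp only [mem_filter, mem_univ, true_and]
    tauto
  all_goals
    rw [Finset.disjoint_left]
    intro v h1 h2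
    simp only [mem_filter, mem_univ, true_and, mem_union] at h1 h2
    tauto

theorem card_odd_palindromes_of_even {k n : ℕ} (hn : 1 < n) (hk : Even k) :
    #{v : Word k (n - 1) | reflect v = v ∧ Odd (k + if PalExtendable v then 1 else 0)} = k := by
  conv_rhs => rw [← card_palindromes_palExtendable (k := k) hn]
  congr 1
  ext v
  by_cases h : PalExtendable v <;> simp [h, hk, parity_simps]

theorem card_odd_palindromes_of_odd {k n : ℕ} (hn : 1 < n) (hk : Odd k) :
    #{v : Word k (n - 1) | reflect v = v ∧ Odd (k + if PalExtendable v then 1 else 0)} + k =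
      k ^ (n / 2) := by
  have h : n / 2 = (n - 1 + 1) / 2 := by omega
  rw [h, ← card_palindromes k (n - 1)]
  refine (congrArg (_ + ·) (card_palindromes_palExtendable (k := k) hn).symm).trans ?_
  rw [← card_union_of_disjoint, ← filter_or]
  · congr 1
    ext v
    by_cases h : PalExtendable v <;> simp [h, hk, parity_simps]
  · rw [Finset.disjoint_left]
    intro v h1 h2
    simp only [mem_filter, mem_univ, true_and] at h1 h2
    have h3 := h1.2
    rw [if_pos h2.2] at h3
    exact absurd h3 (by simpa [parity_simps] using hk)

theorem ov_of_even_of_even {k n : ℕ} (hn : 1 < n) (hn' : Even n) (hk : Even k) :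
    (ov k n : ℤ) = (k : ℤ) ^ (n / 2) := by
  have h1 := card_nonpalindromes_eq (k := k) hn
  have h2 := card_odd_palindromes_of_even (k := k) hn hk
  have h3 := card_doubly_palExtendable_of_even (k := k) hn hn'
  have h4 := ov_eq_card (k := k) hn
  have h5 : (n + 1) / 2 = n / 2 := by rw [Nat.even_iff] at hn'; omega
  rw [h5] at h1
  exact_mod_cast (by omega : ov k n = k ^ (n / 2))

theorem ov_of_odd_of_even {k n : ℕ} (hn : 1 < n) (hn' : Odd n) (hk : Even k) :
    (ov k n : ℤ) = (k : ℤ) ^ ((n + 1) / 2) - (k : ℤ) ^ 2 + k := by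
  have h1 := card_nonpalindromes_eq (k := k) hn
  have h2 := card_odd_palindromes_of_even (k := k) hn hk
  have h3 := card_doubly_palExtendable_of_odd (k := k) hn hn'
  have h4 := ov_eq_card (k := k) hn
  have h6 := Nat.le_mul_self k
  have h7 : ov k n + k ^ 2 = k ^ ((n + 1) / 2) + k := by rw [sq]; omega
  have h8 := congrArg (Nat.cast : ℕ → ℤ) h7
  push_cast at h8
  linarith

theorem ov_of_even_of_odd {k n : ℕ} (hn : 1 < n) (hn' : Even n) (hk : Odd k) :
    (ov k n : ℤ) = 2 * ((k : ℤ) ^ (n / 2) - k) := by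
  have h1 := card_nonpalindromes_eq (k := k) hn
  have h2 := card_odd_palindromes_of_odd (k := k) hn hk
  have h3 := card_doubly_palExtendable_of_even (k := k) hn hn'
  have h4 := ov_eq_card (k := k) hn
  have h5 : (n + 1) / 2 = n / 2 := by rw [Nat.even_iff] at hn'; omega
  rw [h5] at h1
  have h7 : ov k n + 2 * k = 2 * k ^ (n / 2) := by omega
  have h8 := congrArg (Nat.cast : ℕ → ℤ) h7
  push_cast at h8
  linarith

theorem ov_of_odd_of_odd {k n : ℕ} (hn : 1 < n) (hn' : Odd n) (hk : Odd k) :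
    (ov k n : ℤ) = (k : ℤ) ^ ((n + 1) / 2) + (k : ℤ) ^ ((n - 1) / 2) - (k : ℤ) ^ 2 - k := by
  have h1 := card_nonpalindromes_eq (k := k) hn
  have h2 := card_odd_palindromes_of_odd (k := k) hn hk
  have h3 := card_doubly_palExtendable_of_odd (k := k) hn hn'
  have h4 := ov_eq_card (k := k) hn
  have h5 : n / 2 = (n - 1) / 2 := by rw [Nat.odd_iff] at hn'; omega
  rw [h5] at h2
  have h6 := Nat.le_mul_self k
  have h7 : ov k n + k ^ 2 + k = k ^ ((n + 1) / 2) + k ^ ((n - 1) / 2) := by rw [sq]; omega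
  have h8 := congrArg (Nat.cast : ℕ → ℤ) h7
  push_cast at h8
  linarith

theorem ov_le_two_iff {k n : ℕ} (hk : 1 < k) (hn : 1 < n) :
    ov k n ≤ 2 ↔ (k = 2 ∨ Odd k) ∧ n ≤ 3 := by
  have hk' : (2 : ℤ) ≤ k := by exact_mod_cast hk
  have hpow : ∀ {i j : ℕ}, i ≤ j → (k : ℤ) ^ i ≤ (k : ℤ) ^ j := fun h =>
    pow_le_pow_right₀ (by linarith) h
  have hcast : ov k n ≤ 2 ↔ (ov k n : ℤ) ≤ 2 := by norm_cast
  rw [hcast]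
  rcases Nat.even_or_odd k with hke | hko
  · have hno : ¬ Odd k := Nat.not_odd_iff_even.2 hke
    simp only [hno, or_false]
    rcases Nat.even_or_odd n with hne | hno
    · rw [ov_of_even_of_even hn hne hke]
      rw [Nat.even_iff] at hne
      constructor
      · intro h
        have h1 := hpow (show 1 ≤ n / 2 by omega)
        refine ⟨?_, ?_⟩
        · zify; linarith
        · by_contra! h3
          have h2 := hpow (show 2 ≤ n / 2 by omega)
          nlinarith
      · rintro ⟨rfl, h⟩
        obtain rfl : n = 2 := by omega
        norm_num
    · rw [ov_of_odd_of_even hn hno hke]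
      rw [Nat.odd_iff] at hno
      constructor
      · intro h
        have h1 := hpow (show 2 ≤ (n + 1) / 2 by omega)
        refine ⟨?_, ?_⟩
        · zify; linarith
        · by_contra! h3
          have h2 := hpow (show 3 ≤ (n + 1) / 2 by omega)
          -- The hint `k ^ 2 * (k - 2) ≥ 0` makes `k ^ 3 - k ^ 2 + k` at least `k ^ 2 + k`.
          nlinarith [mul_nonneg (sq_nonneg (k : ℤ)) (sub_nonneg.2 hk')]
      · rintro ⟨rfl, h⟩
        obtain rfl : n = 3 := by omega
        norm_num
  · simp only [hko, or_true, true_and]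
    have hk3 : (3 : ℤ) ≤ k := by
      rw [Nat.odd_iff] at hko
      exact_mod_cast (by omega : 3 ≤ k)
    rcases Nat.even_or_odd n with hne | hno
    · rw [ov_of_even_of_odd hn hne hko]
      rw [Nat.even_iff] at hne
      constructor
      · intro h
        by_contra! h3
        have h2 := hpow (show 2 ≤ n / 2 by omega)
        nlinarith
      · intro h
        obtain rfl : n = 2 := by omega
        norm_num
    · rw [ov_of_odd_of_odd hn hno hko]
      rw [Nat.odd_iff] at hno
      constructor
      · intro h
        by_contra! h3
        have h2 := hpow (show 3 ≤ (n + 1) / 2 by omega)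
        have h4 := hpow (show 2 ≤ (n - 1) / 2 by omega)
        nlinarith [mul_nonneg (sq_nonneg (k : ℤ)) (sub_nonneg.2 hk3)]
      · intro h
        obtain rfl : n = 3 := by omega
        norm_num

/-! ### Covering sequences as walks: necessity -/

/-- The word of length `m` that starts at position `i` of the infinite word `c`. -/
def window {k : ℕ} (m : ℕ) (c : ℕ → Fin k) (i : ℕ) : Word k m := fun j => c (i + j)

theorem pre_window {k n : ℕ} (c : ℕ → Fin k) (i : ℕ) :
    pre (window n c i) = window (n - 1) c i := rfl

theorem suf_window {k n : ℕ} (c : ℕ → Fin k) (i : ℕ) :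
    suf (window n c i) = window (n - 1) c (i + 1) := by
  funext j
  simp only [suf, window]
  congr 1
  omega

theorem IsSubword.exists_window {k n : ℕ} {v : Word k n} {s : List (Fin k)} (h : IsSubword v s)
    (d : Fin k) : ∃ i, i + n ≤ s.length ∧ v = window n (fun j => s.getD j d) i := by
  obtain ⟨a, b, rfl⟩ := h
  refine ⟨a.length, by simp, ?_⟩
  funext j
  simp [window, List.getD_eq_getElem?_getD, List.getElem?_append]

theorem exists_cls_window_eq {k n : ℕ} {s : List (Fin k)} (h : CoversReflections k n s)
    (d : Fin k) (a : ReflClass k n) :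
    ∃ i, i + n ≤ s.length ∧ cls (window n (fun j => s.getD j d) i) = a := by
  obtain ⟨v, rfl⟩ := cls_surjective a
  rcases h v with h | h
  · obtain ⟨i, hi, hv⟩ := h.exists_window d
    exact ⟨i, hi, by rw [← hv]⟩
  · obtain ⟨i, hi, hv⟩ := h.exists_window d
    exact ⟨i, hi, by rw [← hv, cls_reflect]⟩

theorem surjective_cls_window {k n : ℕ} {s : List (Fin k)} (h : CoversReflections k n s)
    (d : Fin k) : Function.Surjective fun i : Fin (s.length + 1 - n) =>
      cls (window n (fun j => s.getD j d) i) := by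
  intro a
  obtain ⟨i, hi, ha⟩ := exists_cls_window_eq h d a
  exact ⟨⟨i, by omega⟩, ha⟩

theorem optimalLength_le_of_covers {k n : ℕ} (hk : 1 < k) (hn : 1 < n) {s : List (Fin k)}
    (h : CoversReflections k n s) : optimalLength k n ≤ s.length := by
  have h1 := Fintype.card_le_of_surjective _ (surjective_cls_window h ⟨0, by omega⟩)
  -- Needed because `s.length + 1 - n` is truncated: a nonempty set of classes excludes `s.length <
  -- n`.
  have h2 : 0 < Fintype.card (ReflClass k n) :=
    Fintype.card_pos_iff.2 ⟨cls fun _ => ⟨0, by omega⟩⟩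
  rw [Fintype.card_fin] at h1
  rw [optimalLength_eq k n hn.le]
  omega

/-- The sum telescopes modulo two: along a walk only the two ends affect the parity of a degree. -/
theorem odd_sum_add_succ_iff (g : ℕ → ℕ) (N : ℕ) :
    Odd (∑ i ∈ range N, (g i + g (i + 1))) ↔ Odd (g 0 + g N) := by
  induction N with
  | zero => simp
  | succ N ih =>
    rw [sum_range_succ, Nat.odd_add, ih]
    simp only [parity_simps]
    tauto

theorem ov_le_two_of_covers {k n : ℕ} (hk : 1 < k) (hn : 1 < n) {s : List (Fin k)}
    (h : CoversReflections k n s) (hs : s.length = optimalLength k n) : ov k n ≤ 2 := by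
  set c : ℕ → Fin k := fun j => s.getD j ⟨0, by omega⟩ with hc
  set N := s.length + 1 - n with hN
  have hcard : N = Fintype.card (ReflClass k n) := by
    rw [optimalLength_eq k n hn.le] at hs
    omega
  -- At optimal length there are as many windows as classes, so each edge is traversed exactly once.
  have hbij : Function.Bijective fun i : Fin N => cls (window n c i) :=
    (Fintype.bijective_iff_surjective_and_card _).2
      ⟨surjective_cls_window h _, by rw [Fintype.card_fin, hcard]⟩
  have hsub : {x : ReflClass k (n - 1) | Odd (degree k n x)} ⊆
      {cls (window (n - 1) c 0), cls (window (n - 1) c N)} := by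
    intro x hx
    have hdeg : degree k n x = ∑ i ∈ range N,
        ((if cls (window (n - 1) c i) = x then 1 else 0) +
          if cls (window (n - 1) c (i + 1)) = x then 1 else 0) := by
      rw [degree_eq_sum, ← Fin.sum_univ_eq_sum_range fun i =>
        (if cls (window (n - 1) c i) = x then 1 else 0) +
          if cls (window (n - 1) c (i + 1)) = x then 1 else 0]
      refine (Fintype.sum_bijective _ hbij _ _ fun i => ?_).symm
      rw [endCount_cls, pre_window, suf_window]
    rw [Set.mem_ofPred_eq, hdeg,
      odd_sum_add_succ_iff fun i => if cls (window (n - 1) c i) = x then 1 else 0] at hx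
    by_contra hcon
    simp only [Set.mem_insert_iff, Set.mem_singleton_iff, not_or] at hcon
    rw [if_neg (Ne.symm hcon.1), if_neg (Ne.symm hcon.2)] at hx
    exact absurd hx (by decide)
  exact (Set.ncard_le_ncard hsub (Set.toFinite _)).trans 
    ((Set.ncard_insert_le _ _).trans (by rw [Set.ncard_singleton]))

/-! ### Longest trails -/

/-- A trail: a list of words in which consecutive words overlap in `n - 1` letters and whose
reflection classes are distinct. -/
def IsTrail {k n : ℕ} (l : List (Word k n)) : Prop :=
  l.IsChain (fun e f => suf e = pre f) ∧ (l.map cls).Nodup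

/-- A nonempty trail of maximal length. -/
def IsLongestTrail {k n : ℕ} (l : List (Word k n)) : Prop :=
  IsTrail l ∧ l ≠ [] ∧ ∀ l' : List (Word k n), IsTrail l' → l'.length ≤ l.length

theorem exists_isLongestTrail {k n : ℕ} (hk : 0 < k) :
    ∃ l : List (Word k n), IsLongestTrail l := by
  have hb : ∀ m, (∃ l : List (Word k n), IsTrail l ∧ l.length = m) →
      m ≤ Fintype.card (ReflClass k n) := by
    rintro m ⟨l, hl, rfl⟩
    simpa using hl.2.length_le_card
  have h1 : IsTrail [(fun _ => ⟨0, hk⟩ : Word k n)] := ⟨by simp, by simp⟩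
  have hex : ∃ l : List (Word k n), IsTrail l ∧ l.length = 1 := ⟨_, h1, rfl⟩
  obtain ⟨l, hl, hlen⟩ := Nat.findGreatest_spec
    (P := fun m => ∃ l : List (Word k n), IsTrail l ∧ l.length = m) (hb 1 hex) hex
  have hmax : ∀ l' : List (Word k n), IsTrail l' → l'.length ≤ l.length := by
    intro l' hl'
    rw [hlen]
    exact Nat.le_findGreatest (hb _ ⟨l', hl', rfl⟩) ⟨l', hl', rfl⟩
  refine ⟨l, hl, ?_, hmax⟩
  rintro rfl
  simpa using hmax _ h1

theorem IsLongestTrail.mem_of_pre_eq {k n : ℕ} {l : List (Word k n)} {e f : Word k n}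
    (h : IsLongestTrail (l ++ [e])) (hf : pre f = suf e) : cls f ∈ (l ++ [e]).map cls := by
  by_contra hcon
  have ht : IsTrail ((l ++ [e]) ++ [f]) := by
    refine ⟨?_, ?_⟩
    · rw [List.isChain_append]
      refine ⟨h.1.1, by simp, ?_⟩
      simp [hf]
    · rw [List.map_append, List.nodup_append]
      refine ⟨h.1.2, by simp, ?_⟩
      intro a ha b hb hab
      simp only [List.map_cons, List.map_nil, List.mem_singleton] at hb
      exact hcon (hb ▸ hab ▸ ha)
  have := h.2.2 _ ht
  simp at this

theorem IsLongestTrail.mem_of_suf_eq {k n : ℕ} {l : List (Word k n)} {e f : Word k n}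
    (h : IsLongestTrail (e :: l)) (hf : suf f = pre e) : cls f ∈ (e :: l).map cls := by
  by_contra hcon
  have ht : IsTrail (f :: e :: l) :=
    ⟨List.isChain_cons_cons.2 ⟨hf, h.1.1⟩, List.nodup_cons.2 ⟨hcon, h.1.2⟩⟩
  have := h.2.2 _ ht
  simp at this

/-- Inside a chain each suffix is the next prefix, so the two counts differ only at the ends. -/
theorem count_pre_add_eq {k n : ℕ} (v : Word k (n - 1)) (e : Word k n) (l : List (Word k n))
    (h : (e :: l).IsChain fun e f => suf e = pre f) :
    ((e :: l).map fun f => if pre f = v then 1 else 0).sum +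
        (if suf ((e :: l).getLast (by simp)) = v then 1 else 0) =
      ((e :: l).map fun f => if suf f = v then 1 else 0).sum + if pre e = v then 1 else 0 := by
  induction l generalizing e with
  | nil =>
    simp only [List.map_cons, List.map_nil, List.sum_cons, List.sum_nil, add_zero]
    exact add_comm _ _
  | cons f l ih =>
    rw [List.isChain_cons_cons] at h
    have h1 := ih f h.2
    rw [List.getLast_cons (by simp), List.map_cons, List.map_cons (a := e), List.sum_cons,
      List.sum_cons, h.1]
    omega

theorem sum_outCount_list {k n : ℕ} (v : Word k (n - 1)) (l : List (Word k n)) :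
    ((l.map cls).map (outCount v)).sum =
      (l.map fun f => if pre f = v then 1 else 0).sum +
        (l.map fun f => if suf f = reflect v then 1 else 0).sum := by
  rw [← List.sum_map_add, List.map_map]
  rfl

theorem IsTrail.sum_outCount_eq {k n : ℕ} {l : List (Word k n)} (h : IsTrail l)
    (v : Word k (n - 1)) :
    ((l.map cls).map (outCount v)).sum = ∑ a ∈ (l.map cls).toFinset, outCount v a :=
  (List.sum_toFinset _ h.2).symm

theorem IsTrail.sum_outCount_le {k n : ℕ} (hn : 1 < n)
    (hext : ∀ v : Word k (n - 1), PalExtendable v) {l : List (Word k n)} (h : IsTrail l)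
    (v : Word k (n - 1)) : ((l.map cls).map (outCount v)).sum ≤ k + 1 := by
  rw [h.sum_outCount_eq]
  refine (sum_le_sum_of_subset (subset_univ _)).trans ?_
  rw [sum_outCount hn, if_pos (hext v)]

/-- Let the trail end at `v` without starting there. By maximality it uses all `k + 1` ends on side
`v`. If `v` is a palindrome, that number would be odd, against `k` odd. Otherwise the trail arrives
at `v` once more than it leaves, and side `v'` would need at least `k + 2` ends. -/
theorem IsLongestTrail.closed {k n : ℕ} (hk : Odd k) (hn : 1 < n)
    (hext : ∀ v : Word k (n - 1), PalExtendable v) {e : Word k n} {l : List (Word k n)}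
    (h : IsLongestTrail (e :: l)) : suf ((e :: l).getLast (by simp)) = pre e := by
  obtain ⟨l', e', hl⟩ : ∃ l' e', e :: l = l' ++ [e'] :=
    ⟨_, _, (List.dropLast_append_getLast (by simp)).symm⟩
  have hlast : (e :: l).getLast (by simp) = e' := by simp [hl]
  set v := suf ((e :: l).getLast (by simp)) with hv
  have hfull : (((e :: l).map cls).map (outCount v)).sum = k + 1 := by
    rw [h.1.sum_outCount_eq]
    refine Eq.trans ?_ ((sum_outCount hn v).trans (by rw [if_pos (hext v)]))
    -- An unused class leaving `v` could be appended, reflected if necessary.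
    refine sum_subset (subset_univ _) fun a _ ha => ?_
    obtain ⟨f, rfl⟩ := cls_surjective a
    rw [List.mem_toFinset, hl] at ha
    rw [hl] at h
    rw [hlast] at hv
    have hpre : pre f ≠ v := fun hf => ha (h.mem_of_pre_eq (hf.trans hv))
    have hsuf : suf f ≠ reflect v := by
      intro hf
      refine ha ?_
      rw [← cls_reflect]
      exact h.mem_of_pre_eq (by rw [pre_reflect, hf, reflect_reflect, hv])
    rw [outCount_cls, if_neg hpre, if_neg hsuf, add_zero]
  have hle := h.1.sum_outCount_le hn hext (reflect v)
  rw [sum_outCount_list] at hfull hle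
  rw [reflect_reflect] at hle
  have h1 := count_pre_add_eq v e l h.1.1
  have h2 := count_pre_add_eq (reflect v) e l h.1.1
  rw [← hv] at h1 h2
  rw [if_pos rfl] at h1
  by_contra hne
  rw [if_neg (Ne.symm hne)] at h1
  by_cases hpal : reflect v = v
  · rw [hpal] at hfull
    rw [Nat.odd_iff] at hk
    omega
  · rw [if_neg (Ne.symm hpal)] at h2
    omega

theorem IsLongestTrail.rotate {k n : ℕ} (hk : Odd k) (hn : 1 < n)
    (hext : ∀ v : Word k (n - 1), PalExtendable v) {l₁ l₂ : List (Word k n)}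
    (h : IsLongestTrail (l₁ ++ l₂)) : IsLongestTrail (l₂ ++ l₁) := by
  have hlen : (l₂ ++ l₁).length = (l₁ ++ l₂).length := by simp [add_comm]
  refine ⟨⟨?_, ?_⟩, ?_, ?_⟩
  · have hc := h.1.1
    rw [List.isChain_append] at hc ⊢
    refine ⟨hc.2.1, hc.1, ?_⟩
    intro x hx y hy
    obtain ⟨t, rfl⟩ : ∃ t, l₁ = y :: t := by
      cases l₁ with
      | nil => simp at hy
      | cons a t => simp at hy; exact ⟨t, by rw [hy]⟩
    have hcl := IsLongestTrail.closed hk hn hext (l := t ++ l₂) h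
    have hne : l₂ ≠ [] := by rintro rfl; simp at hx
    rw [List.getLast?_eq_getLast_of_ne_nil hne, Option.mem_def, Option.some_inj] at hx
    rw [← hx, ← hcl]
    congr 1
    exact (List.getLast_append_of_ne_nil (l := y :: t) (by simp) hne).symm
  · have hd := h.1.2
    rw [List.map_append] at hd ⊢
    exact (List.perm_append_comm.nodup_iff).1 hd
  · intro h0
    have := h.2.1
    simp_all
  · intro l' hl'
    rw [hlen]
    exact h.2.2 l' hl'

/-- Rotation brings the class of `f` to the end of the trail, or to its start if it is traversed
reflected; there maximality applies to `g`. -/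
theorem IsLongestTrail.mem_of_overlap {k n : ℕ} (hk : Odd k) (hn : 1 < n)
    (hext : ∀ v : Word k (n - 1), PalExtendable v) {l : List (Word k n)} (h : IsLongestTrail l)
    {f g : Word k n} (hf : cls f ∈ l.map cls) (hfg : suf f = pre g) : cls g ∈ l.map cls := by
  obtain ⟨e, he, hef⟩ := List.mem_map.1 hf
  obtain ⟨l₁, l₂, rfl⟩ := List.append_of_mem he
  rcases (cls_eq_iff e f).1 hef with rfl | rfl
  · have h' : IsLongestTrail (l₂ ++ (l₁ ++ [f])) := by
      refine IsLongestTrail.rotate hk hn hext (l₁ := l₁ ++ [f]) ?_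
      simpa using h
    rw [← List.append_assoc] at h'
    have := h'.mem_of_pre_eq hfg.symm
    simp only [List.map_append, List.map_cons, List.map_nil, List.mem_append,
      List.mem_cons] at this ⊢
    tauto
  · have h' : IsLongestTrail (e :: (l₂ ++ l₁)) :=
      IsLongestTrail.rotate hk hn hext (l₂ := e :: l₂) h
    have := h'.mem_of_suf_eq (f := reflect g)
      (by rw [suf_reflect, ← hfg, suf_reflect, reflect_reflect])
    rw [cls_reflect] at this
    simp only [List.map_append, List.map_cons, List.mem_append,
      List.mem_cons] at this ⊢
    tauto

theorem IsLongestTrail.mem {k n : ℕ} (hk : Odd k) (hn : 1 < n)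
    (hext : ∀ v : Word k (n - 1), PalExtendable v) {l : List (Word k n)} (h : IsLongestTrail l)
    (g : Word k n) : cls g ∈ l.map cls := by
  obtain ⟨f, hf⟩ := List.exists_mem_of_ne_nil _ h.2.1
  -- The word `f` followed by copies of `g`: sliding the window `n` places leads from `f` to `g`
  -- through overlapping words.
  set c : ℕ → Fin k := fun i => if hi : i < n then f ⟨i, hi⟩ else
    g ⟨(i - n) % n, Nat.mod_lt _ (by omega)⟩ with hc
  have key : ∀ i, cls (window n c i) ∈ l.map cls := by
    intro i
    induction i with
    | zero =>
      have : window n c 0 = f := by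
        funext j
        simp [window, hc]
      rw [this]
      exact List.mem_map_of_mem hf
    | succ i ih =>
      exact h.mem_of_overlap hk hn hext ih (by rw [suf_window, pre_window])
  have hg : window n c n = g := by
    funext j
    simp [window, hc, Nat.mod_eq_of_lt j.2]
  rw [← hg]
  exact key n

/-! ### From trails to sequences: sufficiency -/

theorem ofFn_pre_append {k n : ℕ} (hn : 0 < n) (e : Word k n) :
    List.ofFn e = List.ofFn (pre e) ++ [e ⟨n - 1, by omega⟩] := by
  obtain ⟨m, rfl⟩ : ∃ m, n = m + 1 := ⟨n - 1, by omega⟩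
  rw [List.ofFn_succ', List.concat_eq_append]
  rfl

theorem ofFn_eq_cons_suf {k n : ℕ} (hn : 0 < n) (e : Word k n) :
    List.ofFn e = e ⟨0, hn⟩ :: List.ofFn (suf e) := by
  obtain ⟨m, rfl⟩ : ∃ m, n = m + 1 := ⟨n - 1, by omega⟩
  rw [List.ofFn_succ]
  rfl

/-- Each further word adds one letter in front; the prefix clause lets the induction glue it on. -/
theorem exists_sequence_of_isChain {k n : ℕ} (hn : 0 < n) (e : Word k n) (l : List (Word k n))
    (h : (e :: l).IsChain fun e f => suf e = pre f) :
    ∃ s : List (Fin k), s.length = (e :: l).length + (n - 1) ∧ List.ofFn e <+: s ∧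
      ∀ f ∈ e :: l, IsSubword f s := by
  induction l generalizing e with
  | nil =>
    refine ⟨List.ofFn e, by simp; omega, List.prefix_rfl, ?_⟩
    simp [IsSubword]
  | cons f l ih =>
    rw [List.isChain_cons_cons] at h
    obtain ⟨s, hlen, hpre, hsub⟩ := ih f h.2
    have hes : List.ofFn e <+: e ⟨0, hn⟩ :: s := by
      rw [ofFn_eq_cons_suf hn, List.prefix_cons_inj, h.1]
      exact (List.prefix_append _ _).trans ((ofFn_pre_append hn f).symm ▸ hpre)
    refine ⟨e ⟨0, hn⟩ :: s, by simp at hlen ⊢; omega, hes, ?_⟩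
    intro g hg
    rcases List.mem_cons.1 hg with rfl | hg
    · exact hes.isInfix
    · exact (hsub g hg).trans (List.suffix_cons _ _).isInfix

theorem exists_covers_of_odd {k n : ℕ} (hk : Odd k) (hn : 1 < n) (hn' : n ≤ 3) :
    ∃ s : List (Fin k), CoversReflections k n s ∧ s.length = optimalLength k n := by
  have hext : ∀ v : Word k (n - 1), PalExtendable v := palExtendable_of_le_three hn hn'
  obtain ⟨l, hl⟩ := exists_isLongestTrail (n := n) hk.pos
  obtain ⟨e, t, rfl⟩ := List.exists_cons_of_ne_nil hl.2.1
  obtain ⟨s, hlen, -, hsub⟩ := exists_sequence_of_isChain (by omega) e t hl.1.1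
  have hmem := hl.mem hk hn hext
  refine ⟨s, fun v => ?_, ?_⟩
  · obtain ⟨f, hf, hfv⟩ := List.mem_map.1 (hmem v)
    rcases (cls_eq_cls_iff f v).1 hfv with rfl | rfl
    · exact Or.inl (hsub _ hf)
    · exact Or.inr (hsub _ hf)
  · have hall : ((e :: t).map cls).toFinset = univ := by
      ext a
      obtain ⟨v, rfl⟩ := cls_surjective a
      simpa only [List.mem_toFinset, mem_univ, iff_true] using hmem v
    rw [hlen, optimalLength_eq k n hn.le, ← card_univ, ← hall,
      List.toFinset_card_of_nodup hl.1.2, List.length_map]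

/-- Here palindromic vertices have odd degree `3`, so the trail is open: it runs between the two
constant words. -/
theorem exists_covers_two {n : ℕ} (hn : 1 < n) (hn' : n ≤ 3) :
    ∃ s : List (Fin 2), CoversReflections 2 n s ∧ s.length = optimalLength 2 n := by
  obtain rfl | rfl : n = 2 ∨ n = 3 := by omega
  · refine ⟨[0, 0, 1, 1], ?_, by decide⟩
    unfold CoversReflections IsSubword
    decide
  · refine ⟨[0, 0, 0, 1, 0, 1, 1, 1], ?_, by decide⟩
    unfold CoversReflections IsSubword
    decide

end UnorientedDeBruijn

theorem theorem1 (k n : ℕ) (hk : 1 < k) (hn : 1 < n) :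
    ((∃ s : List (Fin k), UnorientedDeBruijn.IsUnorientedDeBruijnSeq k n s ∧
        s.length = UnorientedDeBruijn.optimalLength k n) ↔ (k = 2 ∨ Odd k) ∧ n ≤ 3) ∧
    (Even n → Even k → (UnorientedDeBruijn.ov k n : ℤ) = (k : ℤ) ^ (n / 2)) ∧
    (Odd n → Even k →
      (UnorientedDeBruijn.ov k n : ℤ) = (k : ℤ) ^ ((n + 1) / 2) - (k : ℤ) ^ 2 + k) ∧
    (Even n → Odd k → (UnorientedDeBruijn.ov k n : ℤ) = 2 * ((k : ℤ) ^ (n / 2) - k)) ∧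
    (Odd n → Odd k →
      (UnorientedDeBruijn.ov k n : ℤ) =
        (k : ℤ) ^ ((n + 1) / 2) + (k : ℤ) ^ ((n - 1) / 2) - (k : ℤ) ^ 2 - k) ∧
    (UnorientedDeBruijn.ov k n ≤ 2 ↔ (k = 2 ∨ Odd k) ∧ n ≤ 3) := by
  refine ⟨⟨?_, ?_⟩, UnorientedDeBruijn.ov_of_even_of_even hn,
    UnorientedDeBruijn.ov_of_odd_of_even hn, UnorientedDeBruijn.ov_of_even_of_odd hn,
    UnorientedDeBruijn.ov_of_odd_of_odd hn, UnorientedDeBruijn.ov_le_two_iff hk hn⟩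
  · rintro ⟨s, hs, hlen⟩
    exact (UnorientedDeBruijn.ov_le_two_iff hk hn).1
      (UnorientedDeBruijn.ov_le_two_of_covers hk hn hs.1 hlen)
  · rintro ⟨hk', hn'⟩
    obtain ⟨s, hs, hlen⟩ : ∃ s : List (Fin k), UnorientedDeBruijn.CoversReflections k n s ∧
        s.length = UnorientedDeBruijn.optimalLength k n := by
      rcases hk' with rfl | hk'
      · exact UnorientedDeBruijn.exists_covers_two hn hn'
      · exact UnorientedDeBruijn.exists_covers_of_odd hk' hn hn'
    exact ⟨s, ⟨hs, fun t ht =>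
      hlen.trans_le (UnorientedDeBruijn.optimalLength_le_of_covers hk hn ht)⟩, hlen⟩
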